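/- **Theorem 7.1.** Let $X_0,X_1,\dots$ be an i.i.d. real source with finite second moment whose letters have a density $f$ with finite differential entropy $h=-\int f\log_2 f$ ($f\log_2 f$ integrable), and let $X=(X_0,\dots,X_{L-1})$ be the source word of length $L$. Let $\rho(x,y)=\frac1L\|x-y\|^2$ on $\mathbb R^L$. Let $K\in\mathbb N$, and let $\mathcal K$ be a family of subsets of $\{0,\dots,K-1\}$. *Quantizers.* For every block length $L$ let a $K$-channel lattice vector quantizer be given: a lattice $\Lambda_c\subset\mathbb R^L$ with sublattices $\Lambda_0,\dots,\Lambda_{K-1}$ (each itself a lattice in $\mathbb R^L$), an injective index-assignment map $\alpha=(\alpha_0,\dots,\alpha_{K-1}):\Lambda_c\to\Lambda_0\times\dots\times\Lambda_{K-1}$, a central codebook $\mathcal C_c\subseteq\Lambda_c$ (possibly all of $\Lambda_c$) with a measurable nearest-neighbour quantizer $Q:\mathbb R^L\to\mathcal C_c$, finite side codebooks $\mathcal C_i\subset\Lambda_i$, and decoding functions $g_J:\prod_{j\in J}\Lambda_j\to\mathbb R^L$ for $J\subseteq\{0,\dots,K-1\}$. Put $\lambda_i=\alpha_i(Q(X))$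 and $\lambda_J=(\lambda_j)_{j\in J}$. The side codebooks are matched to the typical set: for some $\varepsilon>0$, with $$A_\varepsilon^{(L)}=\Big\{x\in\mathbb R^L: f(x_l)>0\ \forall l,\ \big|-\tfrac1L\textstyle\sum_l\log_2 f(x_l)-h\big|\le\varepsilon\Big\},$$ we have $P\big(X\in A^{(L)}_\varepsilon,\ \lambda_i\notin\mathcal C_i\big)\to0$ as $L\to\infty$ for every $i$ (in particular this holds if $\alpha_i(Q(x))\in\mathcal C_i$ for all $x\in A_\varepsilon^{(L)}$). A tuple indexed by $J$ is *admissible* if it equals $(\alpha_j(c))_{j\in J}$ for some $c\in\mathcal C_c$. For disjoint $S,T$ and $v\in\prod_{j\in T}\mathcal C_j$, let $\{\lambda_S\,|\,v\}$ be the set of $u\in\prod_{i\in S}\mathcal C_i$ for which $(u,v)$ is admissible. *Random binning.* Let $R_i=\frac1L\log_2|\mathcal C_i|$ and $\gamma_i>0$. Random binning with binning rates $R'_i$ forms $\lfloor 2^{LR'_i}\rfloor$ bins for each $\mathcal C_i$ and fills each bin by $\lceil 2^{L(R_i-R'_i+\gamma_i)}\rceil$ independent uniform draws from $\mathcal C_i$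 with replacement. Channel $i$ carries the least index of the bins that contain $\lambda_i$, or a special symbol if there is none. The decoder that receives the channels in $J$ searches the received bins for an admissible tuple; if there is exactly one, it applies $g_J$ to it, and otherwise it reproduces every letter as $E[X_0]$. *Achievability.* A tuple $\big((r_i)_{i},(D^{(K,J)})_{J\in\mathcal K}\big)$ is achievable if for every $\delta>0$ and all sufficiently large $L$ there are measurable encoders $F_i:\mathbb R^L\to\{1,\dots,\Theta_i\}$ with $\Theta_i\le2^{L(r_i+\delta)}$ and decoders $G_J:\prod_{j\in J}\{1,\dots,\Theta_j\}\to\mathbb R^L$ with $E\,\rho\big(X,G_J((F_j(X))_{j\in J})\big)\le D^{(K,J)}+\delta$ for all $J\in\mathcal K$. *Claim.* Let $R_{b,i}\ge0$, $\gamma_i>0$ for $0\le i<K$ and $D^{(K,J)}\ge0$ for $J\in\mathcal K$. Suppose that for all sufficiently large $L$ and all $J\in\mathcal K$ $$E\big[\rho(X,g_J(\lambda_J))\big]\le D^{(K,J)},$$ and, for all nonempty $S\subseteq J$ and all $\lambda_{J-S}\in\prod_{j\in J-S}\mathcal C_j$ with $\{\lambda_S|\lambda_{J-S}\}\neq\emptyset$,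 $$\sum_{i\in S}R_{b,i}>\sum_{i\in S}\gamma_i+\frac1L\log_2\big|\{\lambda_S|\lambda_{J-S}\}\big|.$$ Then $\big(R_{b,0},\dots,R_{b,K-1},\{D^{(K,J)}\}_{J\in\mathcal K}\big)$ is achievable. Moreover it is achieved by random binning: for every $\delta>0$ and all sufficiently large $L$, random binning with binning rates $R_{b,i}+\delta$ and parameters $\gamma_i$ yields, with probability at least $1-\delta$ over the draws, a scheme whose expected distortion is at most $D^{(K,J)}+\delta$ for all $J\in\mathcal K$ simultaneously. -/

import Mathlib

open MeasureTheory ProbabilityTheory Filter Topology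
open scoped ENNReal NNReal

namespace MDLVQ

/-- Source words of length `L`. -/
abbrev Vec (L : ℕ) : Type := Fin L → ℝ

/-- The squared-error distortion per letter, `ρ(x, y) = (1/L) ∑ (xᵢ - yᵢ)²`. -/
noncomputable def sqErr {L : ℕ} (x y : Vec L) : ℝ := (1 / (L : ℝ)) * ∑ i, (x i - y i) ^ 2

/-! ### The source -/

/-- A real-valued i.i.d. source. -/
structure IsIIDSource {Ω : Type*} [MeasurableSpace Ω] (P : Measure Ω) (X : ℕ → Ω → ℝ) : Prop where
  measurable : ∀ n, Measurable (X n)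
  indep : iIndepFun X P
  ident : ∀ n, IdentDistrib (X n) (X 0) P P

/-- The source word formed by the first `L` letters. -/
def block {Ω : Type*} (X : ℕ → Ω → ℝ) (L : ℕ) (ω : Ω) : Vec L := fun i => X i ω

/-- The probability density function of a source letter. -/
noncomputable def density {Ω : Type*} [MeasurableSpace Ω] (P : Measure Ω) (X : ℕ → Ω → ℝ)
    (x : ℝ) : ℝ := (pdf (X 0) P volume x).toReal

/-- A letter has a density `f`, and `f log₂ f` is integrable. -/
def HasFiniteDiffEntropy {Ω : Type*} [MeasurableSpace Ω] (P : Measure Ω) (X : ℕ → Ω → ℝ) : Prop :=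
  HasPDF (X 0) P volume ∧
    Integrable (fun x => density P X x * Real.logb 2 (density P X x)) volume

/-- The differential entropy `h = -∫ f log₂ f` of a letter, in bits. -/
noncomputable def diffEntropy {Ω : Type*} [MeasurableSpace Ω] (P : Measure Ω) (X : ℕ → Ω → ℝ) : ℝ :=
  -∫ x, density P X x * Real.logb 2 (density P X x)

/-- The `ε`-typical source words of length `L`: those in the support of the density with
`|-(1/L) log₂ f(x₁)⋯f(x_L) - h| ≤ ε`. -/
def typicalSet {Ω : Type*} [MeasurableSpace Ω] (P : Measure Ω) (X : ℕ → Ω → ℝ)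
    (L : ℕ) (ε : ℝ) : Set (Vec L) :=
  {x | (∀ i, 0 < density P X (x i)) ∧
    |-(1 / (L : ℝ)) * ∑ i, Real.logb 2 (density P X (x i)) - diffEntropy P X| ≤ ε}

/-- The expected squared error per letter when the source word `x` is reproduced as `r x`. -/
noncomputable def meanDistortion {Ω : Type*} [MeasurableSpace Ω] (P : Measure Ω)
    (X : ℕ → Ω → ℝ) (L : ℕ) (r : Vec L → Vec L) : ℝ≥0∞ :=
  ∫⁻ ω, ENNReal.ofReal (sqErr (block X L ω) (r (block X L ω))) ∂P

/-! ### Multiple-description codes and achievability -/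

/-- A `K`-channel code of block length `L` whose `i`-th description takes `Θ i` values:
an encoder for each channel and a decoder for each set of received channels. -/
structure Code (K L : ℕ) (Θ : Fin K → ℕ) where
  enc : ∀ i, Vec L → Fin (Θ i)
  enc_measurable : ∀ i, Measurable (enc i)
  dec : ∀ J : Finset (Fin K), (∀ j : J, Fin (Θ j)) → Vec L

/-- Achievability of the rates `R i` (bit per letter) together with the distortions `D J` upon
reception of the descriptions in `J`, for all `J ∈ 𝒦` simultaneously. -/
def Achievable {Ω : Type*} [MeasurableSpace Ω] (P : Measure Ω) (X : ℕ → Ω → ℝ) {K : ℕ}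
    (𝒦 : Finset (Finset (Fin K))) (R : Fin K → ℝ) (D : Finset (Fin K) → ℝ≥0) : Prop :=
  ∀ δ : ℝ, 0 < δ → ∀ᶠ L : ℕ in atTop, ∃ (Θ : Fin K → ℕ) (F : Code K L Θ),
    (∀ i, (Θ i : ℝ) ≤ (2 : ℝ) ^ ((L : ℝ) * (R i + δ))) ∧
    ∀ J ∈ 𝒦, meanDistortion P X L (fun x => F.dec J fun j => F.enc j x) ≤
      (D J : ℝ≥0∞) + ENNReal.ofReal δ

/-! ### Multiple-description lattice vector quantizers -/

/-- `Λ` is a lattice in `ℝ^L`: the integer combinations of a basis, that is, a discrete subgroup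
that spans the space. -/
def IsLattice {L : ℕ} (Λ : Submodule ℤ (Vec L)) : Prop :=
  ∃ _ : DiscreteTopology Λ, IsZLattice ℝ Λ

/-- A `K`-channel lattice vector quantizer in dimension `L`. Geometric similarity and cleanness of
the sublattices, and shift invariance and optimality of the labelling, are not imposed. -/
structure System (K L : ℕ) where
  /-- the central lattice -/
  central : Submodule ℤ (Vec L)
  central_lattice : IsLattice central
  /-- the side lattices, sublattices of the central lattice -/
  side : Fin K → Submodule ℤ (Vec L)
  side_lattice : ∀ i, IsLattice (side i)
  side_le : ∀ i, side i ≤ central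
  /-- the index-assignment map -/
  label : central → ∀ i, side i
  label_injective : Function.Injective label
  /-- the codebook of the central quantizer, finite or not -/
  centralCode : Set central
  /-- the central quantizer: nearest codeword, ties broken arbitrarily but measurably -/
  quant : Vec L → central
  quant_measurable : Measurable fun x => (quant x : Vec L)
  quant_mem : ∀ x, quant x ∈ centralCode
  quant_nearest : ∀ x, ∀ c ∈ centralCode, sqErr x (quant x : Vec L) ≤ sqErr x (c : Vec L)
  /-- the finite codebooks of the side quantizers -/
  sideCode : ∀ i, Finset (side i)

namespace System

variable {K L : ℕ} (s : System K L)

/-- The point of the `i`-th side lattice that is assigned to the source word `x`. -/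
def codeword (i : Fin K) (x : Vec L) : s.side i := s.label (s.quant x) i

/-- A tuple of side-lattice points indexed by `J` is admissible if it is the `J`-part of the
label of a central codeword. -/
def Admissible (J : Finset (Fin K)) (u : ∀ j : J, s.side j) : Prop :=
  ∃ c ∈ s.centralCode, ∀ j : J, s.label c j = u j

/-- The set `{λ_S | λ_T}`: the tuples of side codewords indexed by `S` that form an admissible
tuple together with the tuple `v` of side-lattice points indexed by `T`. -/
def condTuples (S T : Finset (Fin K)) (v : ∀ j : T, s.side j) : Set (∀ i : S, s.side i) :=
  {u | (∀ i : S, u i ∈ s.sideCode i) ∧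
    ∃ c ∈ s.centralCode, (∀ i : S, s.label c i = u i) ∧ ∀ j : T, s.label c j = v j}

/-! #### Random binning of the side codebooks -/

/-- The rate `(1/L) log₂ |𝒞ᵢ|` of the `i`-th side codebook. -/
noncomputable def codeRate (i : Fin K) : ℝ := Real.logb 2 ((s.sideCode i).card : ℝ) / L

/-- The number `2^{LR}` of bins at binning rate `R`, rounded down. -/
noncomputable def numBins (L : ℕ) (R : ℝ) : ℕ := ⌊(2 : ℝ) ^ ((L : ℝ) * R)⌋₊

/-- The number `2^{L(Rᵢ - R + γ)}` of draws per bin, rounded up, where `Rᵢ` is the rate of the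
`i`-th side codebook and `R` the binning rate. -/
noncomputable def binSize (i : Fin K) (R γ : ℝ) : ℕ :=
  ⌈(2 : ℝ) ^ ((L : ℝ) * (s.codeRate i - R + γ))⌉₊

/-- The outcomes of the random binning: every bin of the `i`-th side codebook is filled by drawing
codewords with replacement. Uniform independent draws mean the uniform distribution on this finite
type. -/
abbrev Binning (R γ : Fin K → ℝ) : Type :=
  ∀ i, Fin (numBins L (R i)) → Fin (s.binSize i (R i) (γ i)) → s.sideCode i

variable {s} {R γ : Fin K → ℝ}

/-- The least index of the bins that contain `p`; the special symbol `⊤` if there is none, in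
particular if `p` is not in the `i`-th side codebook. -/
noncomputable def binIndex (B : s.Binning R γ) (i : Fin K) (p : s.side i) :
    WithTop (Fin (numBins L (R i))) := by
  classical exact (Finset.univ.filter fun b => ∃ t, (B i b t : s.side i) = p).min

/-- What is sent over channel `i`: the bin index of the `i`-th codeword of the source word. -/
noncomputable def encode (B : s.Binning R γ) (i : Fin K) (x : Vec L) :
    WithTop (Fin (numBins L (R i))) :=
  binIndex B i (s.codeword i x)

/-- `u` is an admissible tuple that can be found in the bins with the received indices `y`. -/
def IsCandidate (B : s.Binning R γ) (J : Finset (Fin K))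
    (y : ∀ j : J, WithTop (Fin (numBins L (R j)))) (u : ∀ j : J, s.side j) : Prop :=
  s.Admissible J u ∧ ∀ j : J, ∃ (b : Fin (numBins L (R j))) (t : _),
    y j = (b : WithTop (Fin (numBins L (R j)))) ∧ (B j b t : s.side j) = u j

open Classical in
/-- The decoder that receives the descriptions in `J`: if there is exactly one admissible tuple in
the received bins, then `g` is applied to it; otherwise every letter is reproduced as `m`. -/
noncomputable def decode (B : s.Binning R γ) (J : Finset (Fin K))
    (g : (∀ j : J, s.side j) → Vec L) (m : ℝ)
    (y : ∀ j : J, WithTop (Fin (numBins L (R j)))) : Vec L :=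
  if h : ∃! u, IsCandidate B J y u then g h.choose else fun _ => m

/-- The binning `B` yields distortion at most `D J + δ` for every `J ∈ 𝒦`, where `g J` are the
decoding functions, and where a decoder that fails reproduces every letter as the mean of the
source. -/
def IsGood {Ω : Type*} [MeasurableSpace Ω] (P : Measure Ω) (X : ℕ → Ω → ℝ)
    (𝒦 : Finset (Finset (Fin K))) (g : ∀ J : Finset (Fin K), (∀ j : J, s.side j) → Vec L)
    (D : Finset (Fin K) → ℝ≥0) (δ : ℝ) (B : s.Binning R γ) : Prop :=
  ∀ J ∈ 𝒦, meanDistortion P X L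
      (fun x => decode B J (g J) (∫ ω, X 0 ω ∂P) fun j => encode B j x) ≤
    (D J : ℝ≥0∞) + ENNReal.ofReal δ

/-- The probability that random binning with binning rates `R` and excess rates `γ` yields
distortion at most `D J + δ` for every `J ∈ 𝒦`. -/
noncomputable def probGood {Ω : Type*} [MeasurableSpace Ω] (P : Measure Ω) (X : ℕ → Ω → ℝ)
    (𝒦 : Finset (Finset (Fin K))) (s : System K L)
    (g : ∀ J : Finset (Fin K), (∀ j : J, s.side j) → Vec L)
    (D : Finset (Fin K) → ℝ≥0) (R γ : Fin K → ℝ) (δ : ℝ) : ℝ :=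
  (Nat.card {B : s.Binning R γ // IsGood P X 𝒦 g D δ B} : ℝ) / Nat.card (s.Binning R γ)

end System

end MDLVQ

/-! The proof is a random-coding argument. Fix a source word whose codewords all lie in the side
codebooks. Decoding can fail in two ways. Some codeword may be in no bin; with about
$2^{L(R_i+\gamma_i)}$ draws in all, this has probability at most $\exp(-2^{L\gamma_i}/2)$. Or a
wrong admissible tuple may lie in the received bins. Classify such tuples by the nonempty set $S$ of
channels where they differ from the true one: there are at most $|\{\lambda_S|\lambda_{J-S}\}|$ of
them. A given wrong codeword shares the first bin of the true one with probability at most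
$2\cdot2^{L(\gamma_i-R'_i)}$ (`frac_collide_ceil_le`), independently over $i\in S$. With
$R'_i=R_{b,i}+\delta$ the rate condition makes the union bound decay like $2^{-L\delta}$
(`ncard_mul_prod_le`, `frac_decodingFails_le_failureBound`).

By the equipartition property and the matching of the codebooks, words outside the side codebooks
have vanishing probability. Averaging over binnings and Markov's inequality
(`frac_lt_measureReal_le`) then show that most binnings rarely fail. A failure costs only the error
of the constant mean on a rare event, which is small uniformly in $L$ by uniform integrability of
the squared letters. One failure event serves all $J$, so the distortion bounds hold simultaneously.
Any good binning, with one extra symbol per channel, is a code, which gives achievability. -/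

namespace MDLVQ

/-! ### The uniform distribution on a finite type -/

/-- The fraction of the elements of a finite type that satisfy `p`. -/
noncomputable def frac {α : Type*} (p : α → Prop) : ℝ :=
  (Nat.card {a // p a} : ℝ) / Nat.card α

section Frac

variable {α : Type*}

lemma frac_nonneg (p : α → Prop) : 0 ≤ frac p := by
  unfold frac; positivity

variable [Finite α]

lemma frac_mono {p q : α → Prop} (h : ∀ a, p a → q a) : frac p ≤ frac q := by
  unfold frac
  gcongr
  exact Nat.card_le_card_of_injective (Subtype.map id h) (Subtype.map_injective h fun _ _ => id)

lemma frac_le_one (p : α → Prop) : frac p ≤ 1 := by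
  unfold frac
  refine div_le_one_of_le₀ ?_ (by positivity)
  exact_mod_cast Nat.card_le_card_of_injective _ Subtype.val_injective

lemma frac_or_le (p q : α → Prop) : frac (fun a => p a ∨ q a) ≤ frac p + frac q := by
  classical
  have := Fintype.ofFinite α
  unfold frac
  rw [← add_div]
  gcongr
  simp only [Nat.card_eq_fintype_card]
  exact_mod_cast Fintype.card_subtype_or p q

lemma frac_exists_le {ι : Type*} (T : Finset ι) (p : ι → α → Prop) :
    frac (fun a => ∃ i ∈ T, p i a) ≤ ∑ i ∈ T, frac (p i) := by
  classical
  induction T using Finset.induction_on with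
  | empty => simp [frac]
  | insert i T hi ih =>
    rw [Finset.sum_insert hi]
    refine (frac_mono ?_).trans ((frac_or_le (p i) _).trans (add_le_add_right ih _))
    rintro a ⟨j, hj, hja⟩
    rcases Finset.mem_insert.1 hj with rfl | hj
    · exact Or.inl hja
    · exact Or.inr ⟨j, hj, hja⟩

lemma one_sub_frac_le [Nonempty α] (p : α → Prop) : 1 - frac p ≤ frac fun a => ¬ p a := by
  have h := frac_or_le p fun a => ¬ p a
  have : frac (fun a => p a ∨ ¬ p a) = 1 := by
    unfold frac
    have h0 : (Nat.card α : ℝ) ≠ 0 := by exact_mod_cast Nat.card_pos.ne'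
    rw [Nat.card_congr (Equiv.subtypeUnivEquiv fun a => em (p a)), div_self h0]
  linarith

end Frac

lemma frac_pi {ι : Type*} [Fintype ι] {α : ι → Type*} (p : ∀ i, α i → Prop) :
    frac (fun a : ∀ i, α i => ∀ i, p i (a i)) = ∏ i, frac (p i) := by
  unfold frac
  rw [Nat.card_congr (Equiv.subtypePiEquivPi (p := p)), Nat.card_pi, Nat.card_pi]
  push_cast
  rw [Finset.prod_div_distrib]

/-- Independence of the coordinates. Only an inequality is available: a coordinate outside `S` may
have an empty type, where `frac` is `0 / 0 = 0` instead of 1. -/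
lemma frac_forall_mem_le {ι : Type*} [Fintype ι] {α : ι → Type*} [∀ i, Finite (α i)]
    (S : Finset ι) (p : ∀ i, α i → Prop) (c : ι → ℝ) (hc : ∀ i ∈ S, frac (p i) ≤ c i) :
    frac (fun a : ∀ i, α i => ∀ i ∈ S, p i (a i)) ≤ ∏ i ∈ S, c i := by
  classical
  rw [frac_pi fun i a => i ∈ S → p i a,
    ← Finset.prod_mul_prod_compl S fun i => frac fun a => i ∈ S → p i a]
  have h1 : ∏ i ∈ S, frac (fun a => i ∈ S → p i a) ≤ ∏ i ∈ S, c i :=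
    Finset.prod_le_prod (fun _ _ => frac_nonneg _) fun i hi =>
      (frac_mono fun _ ha => ha hi).trans (hc i hi)
  have h2 : ∏ i ∈ Sᶜ, frac (fun a => i ∈ S → p i a) ≤ 1 :=
    Finset.prod_le_one (fun _ _ => frac_nonneg _) fun _ _ => frac_le_one _
  have h3 : 0 ≤ ∏ i ∈ S, c i :=
    Finset.prod_nonneg fun i hi => (frac_nonneg _).trans (hc i hi)
  calc _ ≤ (∏ i ∈ S, c i) * 1 :=
        mul_le_mul h1 h2 (Finset.prod_nonneg fun _ _ => frac_nonneg _) h3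
    _ = _ := mul_one _

lemma frac_eval_le {ι : Type*} [Fintype ι] {α : ι → Type*} [∀ i, Finite (α i)] (i : ι)
    (p : α i → Prop) : frac (fun a : ∀ i, α i => p (a i)) ≤ frac p := by
  -- A predicate on the single type `α i` becomes a family over all `j` by transport along `j = i`.
  have h := frac_forall_mem_le (α := α) {i} (fun j a => ∃ h : j = i, p (h ▸ a))
    (fun j => frac fun a : α j => ∃ h : j = i, p (h ▸ a)) fun _ _ => le_rfl
  simpa using h

/-! ### Filling bins by independent uniform draws -/

section Bins

variable {N M : ℕ} {C : Type*}

/-- `q` lies in the first bin that contains `p`. -/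
def Collide (B : Fin N → Fin M → C) (p q : C) : Prop :=
  ∃ b, (∃ t, B b t = p) ∧ (∀ b' < b, ∀ t, B b' t ≠ p) ∧ ∃ t, B b t = q

/-- The bin `b` is the first one that contains `p`. -/
def IsFirst (B : Fin N → Fin M → C) (p : C) (b : Fin N) : Prop :=
  (∃ t, B b t = p) ∧ ∀ b' < b, ∀ t, B b' t ≠ p

lemma IsFirst.unique {B : Fin N → Fin M → C} {p : C} {b b' : Fin N} (h : IsFirst B p b)
    (h' : IsFirst B p b') : b = b' := by
  obtain ⟨⟨t, ht⟩, h1⟩ := h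
  obtain ⟨⟨t', ht'⟩, h1'⟩ := h'
  rcases lt_trichotomy b b' with hb | hb | hb
  · exact absurd ht (h1' _ hb _)
  · exact hb
  · exact absurd ht' (h1 _ hb _)

variable [Finite C]

/-- Redrawing a slot that holds `q` leaves `b` the first bin with `p`: since `p ≠ q`, the occurrence
of `p` is in another slot, and earlier bins are untouched. The old outcome is recovered by writing
`q` back, so the redrawing map is injective. -/
lemma card_isFirst_and_eq_mul_le {p q : C} (hpq : p ≠ q) (b : Fin N) (t : Fin M) :
    Nat.card {B : Fin N → Fin M → C // IsFirst B p b ∧ B b t = q} * Nat.card C ≤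
      Nat.card {B : Fin N → Fin M → C // IsFirst B p b} := by
  classical
  rw [← Nat.card_prod]
  refine Nat.card_le_card_of_injective
    (fun x => ⟨Function.update x.1.1 b (Function.update (x.1.1 b) t x.2), ?_⟩) ?_
  · obtain ⟨⟨B, ⟨⟨t', ht'⟩, h1⟩, hq⟩, c⟩ := x
    have htt : t' ≠ t := by rintro rfl; exact hpq (ht'.symm.trans hq)
    refine ⟨⟨t', by simp [htt, ht']⟩, fun b' hb' u => ?_⟩
    simpa [hb'.ne] using h1 b' hb' u
  · rintro ⟨⟨B, hB, hq⟩, c⟩ ⟨⟨B', hB', hq'⟩, c'⟩ h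
    have h := congrArg Subtype.val h
    dsimp only at h
    have hval : ∀ b' t', Function.update B b (Function.update (B b) t c) b' t' =
      Function.update B' b (Function.update (B' b) t c') b' t' := fun b' t' => by rw [h]
    have hc : c = c' := by simpa using hval b t
    have hBB : B = B' := by
      funext b' t'
      by_cases hb : b' = b
      · subst hb
        by_cases ht : t' = t
        · subst ht; rw [hq, hq']
        · simpa [ht] using hval b' t'
      · simpa [hb] using hval b' t'
    subst hc hBB
    rfl

lemma frac_isFirst_and_eq_le {p q : C} (hpq : p ≠ q) (b : Fin N) (t : Fin M) :
    frac (fun B : Fin N → Fin M → C => IsFirst B p b ∧ B b t = q) ≤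
      frac (fun B : Fin N → Fin M → C => IsFirst B p b) / Nat.card C := by
  have : Nonempty C := ⟨p⟩
  have hC : (0 : ℝ) < Nat.card C := by exact_mod_cast Nat.card_pos
  rw [le_div_iff₀ hC]
  unfold frac
  rw [div_mul_eq_mul_div]
  gcongr
  exact_mod_cast card_isFirst_and_eq_mul_le hpq b t

lemma sum_frac_isFirst_le (p : C) :
    ∑ b, frac (fun B : Fin N → Fin M → C => IsFirst B p b) ≤ 1 := by
  classical
  unfold frac
  rw [← Finset.sum_div]
  refine div_le_one_of_le₀ ?_ (by positivity)
  rw [← Nat.cast_sum, ← Nat.card_sigma]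
  refine Nat.cast_le.2 (Nat.card_le_card_of_injective (fun x => x.2.1) ?_)
  rintro ⟨b, B, hB⟩ ⟨b', B', hB'⟩ (h : B = B')
  subst h
  obtain rfl := hB.unique hB'
  rfl

/-- The number `N` of bins does not enter: the events that `b` is the first bin with `p` are
disjoint, so their probabilities sum to at most 1 and only the `M` slots of that bin count. -/
lemma frac_collide_le {p q : C} (hpq : p ≠ q) :
    frac (fun B : Fin N → Fin M → C => Collide B p q) ≤ (M : ℝ) / Nat.card C := by
  classical
  calc frac (fun B : Fin N → Fin M → C => Collide B p q)
      ≤ frac (fun B : Fin N → Fin M → C => ∃ b ∈ (Finset.univ : Finset (Fin N)),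
          ∃ t ∈ (Finset.univ : Finset (Fin M)), IsFirst B p b ∧ B b t = q) := by
        refine frac_mono ?_
        rintro B ⟨b, h1, h2, t, h3⟩
        exact ⟨b, by simp, t, by simp, ⟨h1, h2⟩, h3⟩
    _ ≤ ∑ b : Fin N, frac (fun B : Fin N → Fin M → C =>
          ∃ t ∈ (Finset.univ : Finset (Fin M)), IsFirst B p b ∧ B b t = q) :=
        frac_exists_le _ _
    _ ≤ ∑ b : Fin N, ∑ t : Fin M, frac (fun B : Fin N → Fin M → C =>
          IsFirst B p b ∧ B b t = q) := Finset.sum_le_sum fun b _ => frac_exists_le _ _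
    _ ≤ ∑ b : Fin N, ∑ _t : Fin M,
          frac (fun B : Fin N → Fin M → C => IsFirst B p b) / Nat.card C :=
        Finset.sum_le_sum fun b _ => Finset.sum_le_sum fun t _ => frac_isFirst_and_eq_le hpq b t
    _ = (∑ b : Fin N, frac (fun B : Fin N → Fin M → C => IsFirst B p b)) *
          ((M : ℝ) / Nat.card C) := by
        rw [Finset.sum_mul]
        refine Finset.sum_congr rfl fun b _ => ?_
        rw [Finset.sum_const, Finset.card_univ, Fintype.card_fin, nsmul_eq_mul]
        ring
    _ ≤ 1 * ((M : ℝ) / Nat.card C) := by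
        gcongr
        exact sum_frac_isFirst_le p
    _ = _ := one_mul _

/-- Rounding up the bin size costs at most a factor 2. If `Nat.card C * r ≤ 1`, a bin holds at most
one draw and cannot contain two different codewords; otherwise the ceiling is below twice its
argument. -/
lemma frac_collide_ceil_le {p q : C} (hpq : p ≠ q) {r : ℝ} (hr : 0 ≤ r)
    (hM : M = ⌈Nat.card C * r⌉₊) :
    frac (fun B : Fin N → Fin M → C => Collide B p q) ≤ 2 * r := by
  have : Nonempty C := ⟨p⟩
  have hC : (0 : ℝ) < Nat.card C := by exact_mod_cast Nat.card_pos
  rcases le_or_gt (Nat.card C * r) 1 with h | h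
  · have hM1 : M ≤ 1 := by rw [hM]; exact Nat.ceil_le.2 (by simpa using h)
    have : IsEmpty {B : Fin N → Fin M → C // Collide B p q} := by
      refine ⟨?_⟩
      rintro ⟨B, b, ⟨t, ht⟩, -, t', ht'⟩
      have : t = t' := Fin.ext (by omega)
      exact hpq (by rw [← ht, ← ht', this])
    unfold frac
    simp [hr]
  · refine (frac_collide_le hpq).trans ?_
    rw [div_le_iff₀ hC, hM]
    have := Nat.ceil_lt_add_one (show 0 ≤ Nat.card C * r by positivity)
    nlinarith

lemma frac_forall_ne (p : C) :
    frac (fun B : Fin N → Fin M → C => ∀ b t, B b t ≠ p) =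
      ((1 : ℝ) - 1 / Nat.card C) ^ (N * M) := by
  classical
  have : Nonempty C := ⟨p⟩
  have := Fintype.ofFinite C
  have hC : (0 : ℝ) < Nat.card C := by exact_mod_cast Nat.card_pos
  have hone : frac (fun c : C => c ≠ p) = 1 - 1 / Nat.card C := by
    unfold frac
    have h1 : Nat.card {c : C // c ≠ p} = Nat.card C - 1 := by
      simp only [Nat.card_eq_fintype_card]
      rw [Fintype.card_subtype_compl, Fintype.card_subtype_eq]
    rw [h1, Nat.cast_sub Nat.card_pos, sub_div, div_self hC.ne', Nat.cast_one]
  rw [frac_pi (α := fun _ : Fin N => Fin M → C) fun _ B => ∀ t, B t ≠ p]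
  simp_rw [frac_pi (α := fun _ : Fin M => C) fun _ c => c ≠ p, hone]
  simp [← pow_mul, mul_comm]

lemma frac_forall_ne_le (p : C) {r : ℝ} (hr : Nat.card C * r ≤ N * M) :
    frac (fun B : Fin N → Fin M → C => ∀ b t, B b t ≠ p) ≤ Real.exp (-r) := by
  have : Nonempty C := ⟨p⟩
  have hC : (1 : ℝ) ≤ Nat.card C := by exact_mod_cast Nat.card_pos
  rw [frac_forall_ne]
  calc ((1 : ℝ) - 1 / Nat.card C) ^ (N * M) ≤ Real.exp (-(1 / Nat.card C)) ^ (N * M) := by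
        gcongr
        · rw [sub_nonneg]; exact div_le_one_of_le₀ hC (by positivity)
        · linarith [Real.add_one_le_exp (-(1 / (Nat.card C : ℝ)))]
    _ = Real.exp (-(N * M / Nat.card C)) := by
        rw [← Real.exp_nat_mul]; congr 1; push_cast; ring
    _ ≤ _ := by
        gcongr
        rw [le_div_iff₀ (by linarith)]; linarith

end Bins

/-! ### The source: typical words and uniform integrability -/

section Source

variable {Ω : Type*} [MeasurableSpace Ω] {P : Measure Ω} {X : ℕ → Ω → ℝ}

lemma measurable_density (P : Measure Ω) (X : ℕ → Ω → ℝ) : Measurable (density P X) :=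
  (measurable_pdf (X 0) P volume).ennreal_toReal

lemma ae_density_pos [IsProbabilityMeasure P] (hX : IsIIDSource P X)
    (hent : HasFiniteDiffEntropy P X) (n : ℕ) : ∀ᵐ ω ∂P, 0 < density P X (X n ω) := by
  have := hent.1
  have hmeas : MeasurableSet {x | 0 < density P X x} :=
    measurableSet_lt measurable_const (measurable_density P X)
  have h0 : ∀ᵐ x ∂(P.map (X 0)), 0 < density P X x := by
    rw [map_eq_withDensity_pdf (X 0) P volume,
      ae_withDensity_iff (measurable_pdf (X 0) P volume)]
    have hlt : ∀ᵐ x, pdf (X 0) P volume x < ⊤ := pdf.ae_lt_top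
    filter_upwards [hlt] with x hx hne
    exact ENNReal.toReal_pos hne hx.ne
  rw [← (hX.ident n).map_eq] at h0
  exact (ae_map_iff (hX.measurable n).aemeasurable hmeas).1 h0

/-- The asymptotic equipartition property. -/
lemma tendsto_measure_notMem_typicalSet [IsProbabilityMeasure P] (hX : IsIIDSource P X)
    (hent : HasFiniteDiffEntropy P X) {ε : ℝ} (hε : 0 < ε) :
    Tendsto (fun L => P {ω | block X L ω ∉ typicalSet P X L ε}) atTop (𝓝 0) := by
  have := hent.1
  set φ : ℝ → ℝ := fun x => Real.logb 2 (density P X x) with hφ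
  have hφm : Measurable φ := (Real.measurable_log.comp (measurable_density P X)).div_const _
  -- Integrability of $f\log_2 f$ under Lebesgue measure is integrability of $\log_2 f(X_0)$ under
  -- `P`, which is what the strong law needs.
  have hint : Integrable (fun ω => φ (X 0 ω)) P :=
    (pdf.integrable_pdf_smul_iff (X := X 0)
      hφm.aestronglyMeasurable).1 hent.2
  have hval : ∫ ω, φ (X 0 ω) ∂P = -diffEntropy P X := by
    rw [diffEntropy, neg_neg]
    exact (pdf.integral_pdf_smul (X := X 0)
      hφm.aestronglyMeasurable).symm
  have hlln := strong_law_ae_real (μ := P) (fun n ω => φ (X n ω)) hint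
    (fun i j hij => (hX.indep.indepFun hij).comp hφm hφm) fun n => (hX.ident n).comp hφm
  rw [hval] at hlln
  have hmeas := tendstoInMeasure_of_tendsto_ae (μ := P)
    (f := fun n ω => (∑ i ∈ Finset.range n, φ (X i ω)) / n) (g := fun _ => -diffEntropy P X)
    (fun n => ((Finset.measurable_sum _ fun i _ =>
      hφm.comp (hX.measurable i)).div_const _).aestronglyMeasurable) hlln
  refine tendsto_of_tendsto_of_tendsto_of_le_of_le tendsto_const_nhds
    (hmeas (ENNReal.ofReal ε) (by simpa using hε)) (fun _ => zero_le) fun L => ?_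
  have hpos : ∀ᵐ ω ∂P, ∀ n, 0 < density P X (X n ω) :=
    ae_all_iff.2 fun n => ae_density_pos hX hent n
  refine measure_mono_ae ?_
  filter_upwards [hpos] with ω hω hnot
  simp only [edist_dist]
  refine ENNReal.ofReal_le_ofReal ?_
  by_contra hlt
  refine hnot ⟨fun i => hω i, ?_⟩
  rw [Real.dist_eq] at hlt
  have hsum : ∑ i : Fin L, Real.logb 2 (density P X (block X L ω i)) =
      ∑ i ∈ Finset.range L, φ (X i ω) := by
    rw [Finset.sum_range]; rfl
  rw [hsum, ← abs_neg]
  refine le_trans (le_of_eq ?_) (not_le.1 hlt).le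
  congr 1
  ring

/-- The expected distortion of a constant reproduction on an event of small probability is
small, uniformly in the block length. -/
lemma exists_setLIntegral_sqErr_const_le [IsProbabilityMeasure P] (hX : IsIIDSource P X)
    (hX2 : MemLp (X 0) 2 P) (m : ℝ) {δ : ℝ} (hδ : 0 < δ) :
    ∃ η : ℝ, 0 < η ∧ ∀ (L : ℕ), ∀ A : Set Ω, MeasurableSet A → P A ≤ ENNReal.ofReal η →
      ∫⁻ ω in A, ENNReal.ofReal (sqErr (block X L ω) fun _ => m) ∂P ≤ ENNReal.ofReal δ := by
  have hsq : Measurable fun x : ℝ => (x - m) ^ 2 := by fun_prop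
  have hmem : MemLp (fun ω => (X 0 ω - m) ^ 2) 1 P :=
    memLp_one_iff_integrable.2 (hX2.sub (memLp_const m)).integrable_sq
  -- Identically distributed integrable variables are uniformly integrable, so one `η` serves every
  -- letter, hence every average of letters.
  have hUI := MemLp.uniformIntegrable_of_identDistrib (μ := P)
    (f := fun n ω => (X n ω - m) ^ 2) (j := 0) le_rfl ENNReal.one_ne_top hmem
    fun n => (hX.ident n).comp hsq
  obtain ⟨η, hη, h⟩ := hUI.unifIntegrable hδ
  refine ⟨η, hη, fun L A hA hPA => ?_⟩
  have hterm : ∀ n, ∫⁻ ω in A, ENNReal.ofReal ((X n ω - m) ^ 2) ∂P ≤ ENNReal.ofReal δ := by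
    intro n
    refine le_trans (le_of_eq ?_) (h n A hA hPA)
    rw [eLpNorm_one_eq_lintegral_enorm, ← lintegral_indicator hA]
    refine lintegral_congr fun ω => ?_
    by_cases hω : ω ∈ A
    · simp only [Set.indicator_of_mem hω]
      rw [Real.enorm_of_nonneg (sq_nonneg _)]
    · simp [Set.indicator_of_notMem hω]
  have hXm : ∀ n, Measurable fun ω => ENNReal.ofReal ((X n ω - m) ^ 2) := fun n =>
    (hsq.comp (hX.measurable n)).ennreal_ofReal
  calc ∫⁻ ω in A, ENNReal.ofReal (sqErr (block X L ω) fun _ => m) ∂P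
      = ∫⁻ ω in A, ENNReal.ofReal (1 / L) *
          ∑ i : Fin L, ENNReal.ofReal ((X i ω - m) ^ 2) ∂P := by
        refine lintegral_congr fun ω => ?_
        rw [sqErr, ENNReal.ofReal_mul (by positivity),
          ENNReal.ofReal_sum_of_nonneg fun _ _ => sq_nonneg _]
        rfl
    _ = ENNReal.ofReal (1 / L) *
          ∑ i : Fin L, ∫⁻ ω in A, ENNReal.ofReal ((X i ω - m) ^ 2) ∂P := by
        rw [lintegral_const_mul _ (Finset.measurable_sum _ fun (i : Fin L) _ => hXm i),
          lintegral_finsetSum _ fun (i : Fin L) _ => hXm i]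
    _ ≤ ENNReal.ofReal (1 / L) * ∑ _i : Fin L, ENNReal.ofReal δ := by
        gcongr
        exact hterm _
    _ = ENNReal.ofReal (1 / L * L) * ENNReal.ofReal δ := by
        rw [Finset.sum_const, Finset.card_univ, Fintype.card_fin, nsmul_eq_mul,
          ENNReal.ofReal_mul (by positivity), ENNReal.ofReal_natCast, mul_assoc]
    _ ≤ 1 * ENNReal.ofReal δ := by
        gcongr
        rw [ENNReal.ofReal_le_one]
        exact (one_div_mul_eq_div (L : ℝ) L).le.trans (div_self_le_one _)
    _ = _ := one_mul _

end Source

namespace System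

variable {K L : ℕ} {s : System K L} {R γ : Fin K → ℝ}

/-! ### The bin index and the decoder -/

lemma binIndex_eq_coe_iff (B : s.Binning R γ) (i : Fin K) (p : s.side i)
    (b : Fin (numBins L (R i))) :
    binIndex B i p = b ↔
      (∃ t, (B i b t : s.side i) = p) ∧ ∀ b' < b, ∀ t, (B i b' t : s.side i) ≠ p := by
  classical
  unfold binIndex
  constructor
  · intro h
    refine ⟨(Finset.mem_filter.1 (Finset.mem_of_min h)).2, fun b' hb' t ht => ?_⟩
    exact hb'.not_ge (Finset.min_le_of_eq (Finset.mem_filter.2 ⟨Finset.mem_univ _, t, ht⟩) h)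
  · rintro ⟨h1, h2⟩
    refine le_antisymm (Finset.min_le (Finset.mem_filter.2 ⟨Finset.mem_univ _, h1⟩)) ?_
    refine Finset.le_min fun b' hb' => WithTop.coe_le_coe.2 (not_lt.1 fun hlt => ?_)
    obtain ⟨t, ht⟩ := (Finset.mem_filter.1 hb').2
    exact h2 b' hlt t ht

lemma binIndex_eq_top_iff (B : s.Binning R γ) (i : Fin K) (p : s.side i) :
    binIndex B i p = ⊤ ↔ ∀ b t, (B i b t : s.side i) ≠ p := by
  classical
  unfold binIndex
  rw [Finset.min_eq_top, Finset.filter_eq_empty_iff]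
  simp

lemma isCandidate_codeword (B : s.Binning R γ) (J : Finset (Fin K)) (x : Vec L)
    (h : ∀ j ∈ J, encode B j x ≠ ⊤) :
    IsCandidate B J (fun j => encode B j x) fun j => s.codeword j x := by
  refine ⟨⟨s.quant x, s.quant_mem x, fun _ => rfl⟩, fun j => ?_⟩
  obtain ⟨b, hb⟩ := WithTop.ne_top_iff_exists.1 (h j j.2)
  obtain ⟨⟨t, ht⟩, -⟩ := (binIndex_eq_coe_iff B j (s.codeword j x) b).1 hb.symm
  exact ⟨b, t, hb.symm, ht⟩

lemma IsCandidate.encode_ne_top {B : s.Binning R γ} {J : Finset (Fin K)} {x : Vec L}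
    {u : ∀ j : J, s.side j} (h : IsCandidate B J (fun j => encode B j x) u) (j : Fin K)
    (hj : j ∈ J) : encode B j x ≠ ⊤ := by
  obtain ⟨b, -, hb, -⟩ := h.2 ⟨j, hj⟩
  exact fun h => WithTop.coe_ne_top (hb.symm.trans h)

/-- Any candidate at all forces every received index to differ from `⊤`. The true tuple is then a
candidate too, so a unique candidate must be the true one. -/
lemma decode_encode (B : s.Binning R γ) (J : Finset (Fin K)) (g : (∀ j : J, s.side j) → Vec L)
    (m : ℝ) (x : Vec L) (h : ∃! u, IsCandidate B J (fun j => encode B j x) u) :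
    decode B J g m (fun j => encode B j x) = g fun j => s.codeword j x := by
  unfold decode
  rw [dif_pos h]
  exact congrArg g
    (h.choose_spec.2 _ (isCandidate_codeword B J x h.choose_spec.1.encode_ne_top)).symm

/-- Some decoder with index set in `𝒦` does not find exactly one admissible tuple. -/
def DecodingFails (𝒦 : Finset (Finset (Fin K))) (B : s.Binning R γ) (x : Vec L) : Prop :=
  ∃ J ∈ 𝒦, ¬ ∃! u, IsCandidate B J (fun j => encode B j x) u

/-! ### The probability of a decoding failure -/

lemma finite_condTuples (s : System K L) (S T : Finset (Fin K)) (v : ∀ j : T, s.side j) :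
    (s.condTuples S T v).Finite :=
  (Set.Finite.pi' fun i : S => (s.sideCode i).finite_toSet).subset fun _ hu => hu.1

lemma DecodingFails.exists_collide {𝒦 : Finset (Finset (Fin K))} {B : s.Binning R γ} {x : Vec L}
    (h : DecodingFails 𝒦 B x) (c : ∀ i, s.sideCode i)
    (hc : ∀ i, (c i : s.side i) = s.codeword i x) :
    (∃ i ∈ (Finset.univ : Finset (Fin K)), ∀ b t, B i b t ≠ c i) ∨
      ∃ J ∈ 𝒦, ∃ S ∈ J.powerset.filter (·.Nonempty),
        ∃ w ∈ (s.finite_condTuples S (J \ S) fun j => s.codeword j x).toFinset,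
          ∀ i ∈ S, ∃ (hi : i ∈ S) (q : s.sideCode i),
            (q : s.side i) = w ⟨i, hi⟩ ∧ c i ≠ q ∧ Collide (B i) (c i) q := by
  classical
  rw [or_iff_not_imp_left]
  intro hbins
  have hne : ∀ i, encode B i x ≠ ⊤ := by
    intro i hi
    refine hbins ⟨i, Finset.mem_univ _, fun b t hbt => ?_⟩
    exact (binIndex_eq_top_iff B i _).1 hi b t (by rw [hbt, hc])
  obtain ⟨J, hJ, hJu⟩ := h
  have hcand := isCandidate_codeword B J x fun j _ => hne j
  obtain ⟨u, hu, huc⟩ : ∃ u, IsCandidate B J (fun j => encode B j x) u ∧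
      u ≠ fun j : J => s.codeword j x := by
    by_contra hcon
    push Not at hcon
    exact hJu ⟨_, hcand, hcon⟩
  -- `S` is the exact set of disagreement: off `S` the wrong tuple agrees with the true one, so its
  -- `S`-part is counted by `condTuples`, and on `S` every channel contributes a collision.
  set S : Finset (Fin K) := J.filter fun j => ∃ hj : j ∈ J, u ⟨j, hj⟩ ≠ s.codeword j x with hS
  have hSJ : ∀ i ∈ S, i ∈ J := fun i hi => (Finset.mem_filter.1 hi).1
  have hSu : ∀ i (hi : i ∈ S), u ⟨i, hSJ i hi⟩ ≠ s.codeword i x := fun i hi =>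
    (Finset.mem_filter.1 hi).2.2
  refine ⟨J, hJ, S, ?_, fun i : S => u ⟨i, hSJ i i.2⟩, ?_, ?_⟩
  · rw [Finset.mem_filter, Finset.mem_powerset]
    refine ⟨fun i hi => hSJ i hi, ?_⟩
    obtain ⟨j, hj⟩ := Function.ne_iff.1 huc
    exact ⟨j, Finset.mem_filter.2 ⟨j.2, j.2, hj⟩⟩
  · rw [Set.Finite.mem_toFinset]
    refine ⟨fun i => ?_, ?_⟩
    · obtain ⟨b, t, -, ht⟩ := hu.2 ⟨i, hSJ i i.2⟩
      change u ⟨i, hSJ i i.2⟩ ∈ s.sideCode i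
      rw [← ht]
      exact (B i b t).2
    · obtain ⟨a, ha, hau⟩ := hu.1
      refine ⟨a, ha, fun i => hau ⟨i, hSJ i i.2⟩, fun j => ?_⟩
      have hj := Finset.mem_sdiff.1 j.2
      refine (hau ⟨j, hj.1⟩).trans ?_
      by_contra hne
      exact hj.2 (Finset.mem_filter.2 ⟨hj.1, hj.1, hne⟩)
  · intro i hi
    obtain ⟨b, t, hb, ht⟩ := hu.2 ⟨i, hSJ i hi⟩
    obtain ⟨⟨t', ht'⟩, hfirst⟩ := (binIndex_eq_coe_iff B i _ b).1 hb
    refine ⟨hi, B i b t, ht, fun h => ?_, b, ⟨t', ?_⟩, fun b' hb' t'' h => ?_, t, rfl⟩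
    · refine hSu i hi (ht.symm.trans ?_)
      rw [← hc i, h]
    · exact Subtype.ext (ht'.trans (hc i).symm)
    · exact hfirst b' hb' t'' (by rw [h, hc])

/-- Uses $2^{LR_i}=|\mathcal C_i|$, which needs `L ≠ 0` and a nonempty codebook because of the
default values of division and `Real.logb`. -/
lemma binSize_eq (s : System K L) (hL : L ≠ 0) (i : Fin K) (hi : (s.sideCode i).Nonempty)
    (r g : ℝ) :
    s.binSize i r g = ⌈Nat.card (s.sideCode i) * (2 : ℝ) ^ ((L : ℝ) * (g - r))⌉₊ := by
  have hL' : (L : ℝ) ≠ 0 := Nat.cast_ne_zero.2 hL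
  have hcard : (0 : ℝ) < (s.sideCode i).card := by exact_mod_cast hi.card_pos
  have h : (L : ℝ) * (s.codeRate i - r + g) =
      Real.logb 2 (s.sideCode i).card + (L : ℝ) * (g - r) := by
    unfold codeRate
    field_simp
    ring
  have hN : Nat.card (s.sideCode i) = (s.sideCode i).card := Nat.card_eq_finsetCard _
  unfold binSize
  rw [h, Real.rpow_add two_pos, Real.rpow_logb two_pos (by norm_num) hcard, hN]

lemma le_numBins {r : ℝ} (hr : 0 ≤ r) : (2 : ℝ) ^ ((L : ℝ) * r) / 2 ≤ numBins L r := by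
  have h1 : (1 : ℝ) ≤ (2 : ℝ) ^ ((L : ℝ) * r) :=
    Real.one_le_rpow (by norm_num) (by positivity)
  have h2 := Nat.lt_floor_add_one ((2 : ℝ) ^ ((L : ℝ) * r))
  have h3 : (1 : ℝ) ≤ (⌊(2 : ℝ) ^ ((L : ℝ) * r)⌋₊ : ℝ) := by
    exact_mod_cast Nat.le_floor (by simpa using h1)
  unfold numBins
  linarith

lemma frac_codeword_missing_le (hL : L ≠ 0) (i : Fin K) (hR : 0 ≤ R i) (p : s.sideCode i) :
    frac (fun B : s.Binning R γ => ∀ b t, B i b t ≠ p) ≤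
      Real.exp (-((2 : ℝ) ^ ((L : ℝ) * γ i) / 2)) := by
  refine (frac_eval_le (α := fun i => Fin (numBins L (R i)) →
    Fin (s.binSize i (R i) (γ i)) → s.sideCode i) i fun B => ∀ b t, B b t ≠ p).trans ?_
  refine frac_forall_ne_le p ?_
  rw [binSize_eq s hL i ⟨p, p.2⟩]
  have h1 := le_numBins (L := L) hR
  have h2 := Nat.le_ceil (Nat.card (s.sideCode i) * (2 : ℝ) ^ ((L : ℝ) * (γ i - R i)))
  calc (Nat.card (s.sideCode i) : ℝ) * ((2 : ℝ) ^ ((L : ℝ) * γ i) / 2)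
      = (2 : ℝ) ^ ((L : ℝ) * R i) / 2 *
          (Nat.card (s.sideCode i) * (2 : ℝ) ^ ((L : ℝ) * (γ i - R i))) := by
        have : (L : ℝ) * γ i = (L : ℝ) * R i + (L : ℝ) * (γ i - R i) := by ring
        rw [this, Real.rpow_add two_pos]
        ring
    _ ≤ _ := mul_le_mul h1 h2 (by positivity) (by positivity)

lemma frac_forall_collide_le (hL : L ≠ 0) (S : Finset (Fin K)) (c : ∀ i, s.sideCode i)
    (w : ∀ i : S, s.side i) :
    frac (fun B : s.Binning R γ => ∀ i ∈ S, ∃ (hi : i ∈ S) (q : s.sideCode i),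
      (q : s.side i) = w ⟨i, hi⟩ ∧ c i ≠ q ∧ Collide (B i) (c i) q) ≤
      ∏ i ∈ S, 2 * (2 : ℝ) ^ ((L : ℝ) * (γ i - R i)) := by
  refine frac_forall_mem_le S (fun i (a : Fin (numBins L (R i)) →
    Fin (s.binSize i (R i) (γ i)) → s.sideCode i) => ∃ (hi : i ∈ S) (q : s.sideCode i),
      (q : s.side i) = w ⟨i, hi⟩ ∧ c i ≠ q ∧ Collide a (c i) q) _ fun i hi => ?_
  -- If no codeword `q ≠ c i` has the value `w ⟨i, hi⟩`, the event is empty.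
  by_cases h : ∃ q : s.sideCode i, (q : s.side i) = w ⟨i, hi⟩ ∧ c i ≠ q
  · obtain ⟨q, hq, hcq⟩ := h
    refine (frac_mono ?_).trans
      (frac_collide_ceil_le hcq (by positivity) (binSize_eq s hL i ⟨q, q.2⟩ _ _))
    rintro a ⟨_, q', hq', -, hcol⟩
    rwa [Subtype.ext (hq.trans hq'.symm)]
  · refine le_trans (le_of_eq ?_) (by positivity : (0 : ℝ) ≤ _)
    have : IsEmpty {a : Fin (numBins L (R i)) → Fin (s.binSize i (R i) (γ i)) → s.sideCode i //
        ∃ (hi : i ∈ S) (q : s.sideCode i),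
          (q : s.side i) = w ⟨i, hi⟩ ∧ c i ≠ q ∧ Collide a (c i) q} :=
      ⟨fun ⟨_, _, q, hq, hcq, _⟩ => h ⟨q, hq, hcq⟩⟩
    rw [frac, Nat.card_of_isEmpty, Nat.cast_zero, zero_div]

lemma frac_decodingFails_le (hL : L ≠ 0) (hR : ∀ i, 0 ≤ R i) (𝒦 : Finset (Finset (Fin K)))
    (x : Vec L) (hx : ∀ i, s.codeword i x ∈ s.sideCode i) :
    frac (fun B : s.Binning R γ => DecodingFails 𝒦 B x) ≤
      ∑ i, Real.exp (-((2 : ℝ) ^ ((L : ℝ) * γ i) / 2)) +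
      ∑ J ∈ 𝒦, ∑ S ∈ J.powerset.filter (·.Nonempty),
        ((s.condTuples S (J \ S) fun j => s.codeword j x).ncard : ℝ) *
          ∏ i ∈ S, 2 * (2 : ℝ) ^ ((L : ℝ) * (γ i - R i)) := by
  set c : ∀ i, s.sideCode i := fun i => ⟨s.codeword i x, hx i⟩
  refine (frac_mono fun B h => h.exists_collide c fun _ => rfl).trans
    ((frac_or_le _ _).trans (add_le_add ?_ ?_))
  · refine (frac_exists_le _ _).trans (Finset.sum_le_sum fun i _ => ?_)
    exact frac_codeword_missing_le hL i (hR i) (c i)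
  · refine (frac_exists_le _ _).trans (Finset.sum_le_sum fun J _ => ?_)
    refine (frac_exists_le _ _).trans (Finset.sum_le_sum fun S _ => ?_)
    refine (frac_exists_le _ _).trans ((Finset.sum_le_sum fun w _ =>
      frac_forall_collide_le hL S c w).trans (le_of_eq ?_))
    rw [Finset.sum_const, nsmul_eq_mul, Set.ncard_eq_toFinset_card _ (s.finite_condTuples _ _ _)]

/-- A bound on the probability that a decoder fails for a given source word whose codewords lie
in the side codebooks. -/
noncomputable def failureBound {K : ℕ} (γ : Fin K → ℝ) (δ : ℝ) (L : ℕ) : ℝ :=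
  ∑ i, Real.exp (-((2 : ℝ) ^ ((L : ℝ) * γ i) / 2)) + 8 ^ K * (2 : ℝ) ^ (-((L : ℝ) * δ))

lemma tendsto_failureBound (hγ : ∀ i, 0 < γ i) {δ : ℝ} (hδ : 0 < δ) :
    Tendsto (failureBound γ δ) atTop (𝓝 0) := by
  have hpow : ∀ a : ℝ, 0 < a → Tendsto (fun L : ℕ => (2 : ℝ) ^ ((L : ℝ) * a)) atTop atTop :=
    fun a ha => (tendsto_rpow_atTop_of_base_gt_one 2 (by norm_num)).comp
      (tendsto_natCast_atTop_atTop.atTop_mul_const ha)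
  have h1 : Tendsto (fun L : ℕ => ∑ i, Real.exp (-((2 : ℝ) ^ ((L : ℝ) * γ i) / 2))) atTop
      (𝓝 (∑ _i : Fin K, 0)) := tendsto_finsetSum _ fun i _ =>
    Real.tendsto_exp_neg_atTop_nhds_zero.comp ((hpow _ (hγ i)).atTop_div_const two_pos)
  have h2 : Tendsto (fun L : ℕ => (8 : ℝ) ^ K * (2 : ℝ) ^ (-((L : ℝ) * δ))) atTop
      (𝓝 (8 ^ K * 0)) := by
    refine Tendsto.const_mul _ ?_
    simp_rw [Real.rpow_neg zero_le_two]
    exact (hpow δ hδ).inv_tendsto_atTop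
  have h := h1.add h2
  rw [Finset.sum_const_zero, mul_zero, add_zero] at h
  exact h

/-- The rate condition alone only bounds $n\prod_{i\in S}2^{L(\gamma_i-R_{b,i})}$ by 1. The decay
comes from the surplus `δ` in each binning rate, which is present at least once as `S` is nonempty.
-/
lemma ncard_mul_prod_le {Rb : Fin K → ℝ} {δ : ℝ} (hδ : 0 < δ) (hL : L ≠ 0)
    {S : Finset (Fin K)} (hS : S.Nonempty) {n : ℕ}
    (hn : 0 < n → ∑ i ∈ S, γ i + (1 / (L : ℝ)) * Real.logb 2 n < ∑ i ∈ S, Rb i) :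
    (n : ℝ) * ∏ i ∈ S, 2 * (2 : ℝ) ^ ((L : ℝ) * (γ i - (Rb i + δ))) ≤
      2 ^ K * (2 : ℝ) ^ (-((L : ℝ) * δ)) := by
  have hL' : (0 : ℝ) < L := by exact_mod_cast Nat.pos_of_ne_zero hL
  rcases Nat.eq_zero_or_pos n with rfl | hn0
  · simp; positivity
  have hn0' : (0 : ℝ) < n := by exact_mod_cast hn0
  have hcard : 1 ≤ S.card := hS.card_pos
  have hcard' : (1 : ℝ) ≤ S.card := by exact_mod_cast hcard
  have hlog : Real.logb 2 n ≤ (L : ℝ) * (∑ i ∈ S, Rb i - ∑ i ∈ S, γ i) := by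
    have := hn hn0
    rw [← sub_pos] at this
    have := mul_pos hL' this
    field_simp at this
    linarith
  rw [Finset.prod_mul_distrib, Finset.prod_const,
    ← Real.rpow_sum_of_pos two_pos, ← Real.rpow_logb two_pos (by norm_num) hn0', mul_left_comm,
    ← Real.rpow_add two_pos]
  have hsum : ∑ i ∈ S, (L : ℝ) * (γ i - (Rb i + δ)) =
      (L : ℝ) * (∑ i ∈ S, γ i - ∑ i ∈ S, Rb i) - S.card * (L * δ) := by
    rw [← Finset.mul_sum, Finset.sum_sub_distrib, Finset.sum_add_distrib, Finset.sum_const,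
      nsmul_eq_mul]
    ring
  refine mul_le_mul ?_ ?_ (by positivity) (by positivity)
  · refine pow_le_pow_right₀ (by norm_num) ?_
    simpa using Finset.card_le_univ S
  · refine Real.rpow_le_rpow_of_exponent_le (by norm_num) ?_
    rw [hsum]
    have : (L : ℝ) * δ ≤ S.card * (L * δ) := le_mul_of_one_le_left (by positivity) hcard'
    linarith

lemma frac_decodingFails_le_failureBound {Rb : Fin K → ℝ} {δ : ℝ} (hδ : 0 < δ) (hL : L ≠ 0)
    (hRb : ∀ i, 0 ≤ Rb i) {𝒦 : Finset (Finset (Fin K))}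
    (hrate : ∀ J ∈ 𝒦, ∀ S ⊆ J, S.Nonempty →
      ∀ v : ∀ j : ↥(J \ S), s.side j, (∀ j : ↥(J \ S), v j ∈ s.sideCode j) →
        (s.condTuples S (J \ S) v).Nonempty →
        ∑ i ∈ S, γ i + (1 / (L : ℝ)) * Real.logb 2 (s.condTuples S (J \ S) v).ncard <
          ∑ i ∈ S, Rb i)
    (x : Vec L) (hx : ∀ i, s.codeword i x ∈ s.sideCode i) :
    frac (fun B : s.Binning (fun i => Rb i + δ) γ => DecodingFails 𝒦 B x) ≤
      failureBound γ δ L := by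
  refine (frac_decodingFails_le hL (fun i => by linarith [hRb i]) 𝒦 x hx).trans
    (add_le_add_right ?_ _)
  have hcard : ∀ T : Finset (Finset (Fin K)), (T.card : ℝ) ≤ 2 ^ K := fun T => by
    have := Finset.card_le_univ T
    rw [Fintype.card_finset, Fintype.card_fin] at this
    exact_mod_cast this
  set e : ℝ := 2 ^ K * (2 : ℝ) ^ (-((L : ℝ) * δ)) with he
  have he0 : 0 ≤ e := by positivity
  -- The constant $8^K$ collects $2^K$ choices of `J`, $2^K$ choices of `S` and the rounding factor
  -- $2^{|S|}\le2^K$.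
  calc _ ≤ ∑ J ∈ 𝒦, ∑ _S ∈ J.powerset.filter (·.Nonempty), e := by
        refine Finset.sum_le_sum fun J hJ => Finset.sum_le_sum fun S hS => ?_
        rw [Finset.mem_filter, Finset.mem_powerset] at hS
        refine ncard_mul_prod_le hδ hL hS.2 fun hn => ?_
        exact hrate J hJ S hS.1 hS.2 _ (fun j => hx j) (Set.nonempty_of_ncard_ne_zero hn.ne')
    _ ≤ ∑ _J ∈ 𝒦, 2 ^ K * e := by
        refine Finset.sum_le_sum fun J _ => ?_
        rw [Finset.sum_const, nsmul_eq_mul]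
        exact mul_le_mul_of_nonneg_right (hcard _) he0
    _ ≤ 2 ^ K * (2 ^ K * e) := by
        rw [Finset.sum_const, nsmul_eq_mul]
        exact mul_le_mul_of_nonneg_right (hcard _) (by positivity)
    _ = _ := by
        rw [he, show (8 : ℝ) = 2 * 2 * 2 by norm_num, mul_pow, mul_pow]
        ring

end System

/-! ### Averaging over the binnings -/

/-- If outside of an event `N` a random condition holds for a fraction of at most `β` of the
elements of a finite type, then few elements satisfy it with probability more than `η`. -/
lemma frac_lt_measureReal_le {Ω : Type*} [MeasurableSpace Ω] (P : Measure Ω)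
    [IsProbabilityMeasure P] {α : Type*} [Finite α] [Nonempty α] {E : α → Set Ω}
    (hE : ∀ a, MeasurableSet (E a)) {N : Set Ω} (hN : MeasurableSet N) {β η : ℝ} (hβ : 0 ≤ β)
    (hη : 0 < η) (h : ∀ ω, ω ∉ N → frac (fun a => ω ∈ E a) ≤ β) :
    frac (fun a => η < P.real (E a)) ≤ (P.real N + β) / η := by
  classical
  have := Fintype.ofFinite α
  have hcard : (0 : ℝ) < Nat.card α := by exact_mod_cast Nat.card_pos
  have hint : ∀ A : Set Ω, MeasurableSet A → Integrable (A.indicator (1 : Ω → ℝ)) P :=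
    fun A hA => (integrable_const (1 : ℝ)).indicator hA
  have hpt : ∀ ω, ∑ a, (E a).indicator (1 : Ω → ℝ) ω ≤
      Nat.card α * (N.indicator (1 : Ω → ℝ) ω + β) := by
    intro ω
    have hsum : ∑ a, (E a).indicator (1 : Ω → ℝ) ω = Nat.card α * frac fun a => ω ∈ E a := by
      unfold frac
      rw [mul_div_cancel₀ _ hcard.ne', Nat.card_eq_fintype_card, Fintype.card_subtype]
      simp [Set.indicator_apply]
    rw [hsum]
    gcongr
    by_cases hω : ω ∈ N
    · rw [Set.indicator_of_mem hω, Pi.one_apply]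
      linarith [frac_le_one fun a => ω ∈ E a]
    · rw [Set.indicator_of_notMem hω, zero_add]
      exact h ω hω
  -- Exchanging the sum over `α` with the integral over the source turns the pointwise bound into a
  -- bound on the average of `P.real (E a)`; Markov's inequality follows.
  have havg : ∑ a, P.real (E a) ≤ Nat.card α * (P.real N + β) := by
    have h1 : ∑ a, P.real (E a) = ∫ ω, ∑ a, (E a).indicator (1 : Ω → ℝ) ω ∂P := by
      rw [integral_finsetSum _ fun a _ => hint _ (hE a)]
      exact Finset.sum_congr rfl fun a _ => (integral_indicator_one (hE a)).symm
    have h2 : ∫ ω, Nat.card α * (N.indicator (1 : Ω → ℝ) ω + β) ∂P =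
        Nat.card α * (P.real N + β) := by
      rw [integral_const_mul, integral_add (hint N hN) (integrable_const β),
        integral_indicator_one hN]
      simp
    rw [h1, ← h2]
    exact integral_mono (integrable_finsetSum _ fun a _ => hint _ (hE a))
      (((hint N hN).add (integrable_const β)).const_mul _) hpt
  have hmarkov : Nat.card {a // η < P.real (E a)} * η ≤ ∑ a, P.real (E a) := by
    rw [Nat.card_eq_fintype_card, Fintype.card_subtype, ← nsmul_eq_mul, ← Finset.sum_const]
    refine (Finset.sum_le_sum fun a ha => (Finset.mem_filter.1 ha).2.le).trans ?_
    exact Finset.sum_le_sum_of_subset_of_nonneg (Finset.filter_subset _ _)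
      fun _ _ _ => measureReal_nonneg
  unfold frac
  rw [div_le_div_iff₀ hcard hη]
  linarith

/-! ### Measurability, and the distortion of a single binning -/

namespace System

variable {K L : ℕ} {s : System K L} {R γ : Fin K → ℝ}

lemma countable_central (s : System K L) : Countable s.central := by
  obtain ⟨_, _⟩ := s.central_lattice
  exact TopologicalSpace.separableSpace_iff_countable.1 inferInstance

/-- A lattice is countable, so the quantizer has countably many values and every condition on its
value is measurable. Encoding, coverage and decoding failure all depend on the source word only
through this value. -/
lemma measurableSet_quant (s : System K L) (p : s.central → Prop) :
    MeasurableSet {x | p (s.quant x)} := by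
  have := s.countable_central
  have h : {x | p (s.quant x)} =
      ⋃ c ∈ {c | p c}, (fun x => (s.quant x : Vec L)) ⁻¹' {(c : Vec L)} := by
    ext x
    simp only [Set.mem_iUnion, Set.mem_preimage, Set.mem_singleton_iff, exists_prop]
    refine ⟨fun hx => ⟨_, hx, rfl⟩, ?_⟩
    rintro ⟨c, hc, hxc⟩
    have : s.quant x = c := Subtype.ext hxc
    exact (congrArg p this).mpr hc
  rw [h]
  exact MeasurableSet.biUnion (Set.to_countable _) fun c _ =>
    s.quant_measurable (measurableSet_singleton _)

lemma measurableSet_decodingFails (𝒦 : Finset (Finset (Fin K))) (B : s.Binning R γ) :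
    MeasurableSet {x | DecodingFails 𝒦 B x} :=
  s.measurableSet_quant fun c =>
    ∃ J ∈ 𝒦, ¬ ∃! u, IsCandidate B J (fun j => binIndex B j (s.label c j)) u

section Source

variable {Ω : Type*} [MeasurableSpace Ω] {P : Measure Ω} {X : ℕ → Ω → ℝ}

lemma measurable_block (hX : IsIIDSource P X) (L : ℕ) : Measurable (block X L) :=
  measurable_pi_lambda _ fun i => hX.measurable i

/-- A binning whose decoders rarely fail yields a distortion close to that of the quantizer. -/
lemma isGood_of_setLIntegral_le (hX : IsIIDSource P X) {𝒦 : Finset (Finset (Fin K))}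
    {g : ∀ J : Finset (Fin K), (∀ j : J, s.side j) → Vec L} {D : Finset (Fin K) → ℝ≥0} {δ : ℝ}
    (hD : ∀ J ∈ 𝒦, meanDistortion P X L (fun x => g J fun j => s.codeword j x) ≤ D J)
    (B : s.Binning R γ)
    (hB : ∫⁻ ω in block X L ⁻¹' {x | DecodingFails 𝒦 B x},
      ENNReal.ofReal (sqErr (block X L ω) fun _ => ∫ ω, X 0 ω ∂P) ∂P ≤ ENNReal.ofReal δ) :
    IsGood P X 𝒦 g D δ B := by
  intro J hJ
  have hmeas := measurable_block hX L
  have hA : MeasurableSet (block X L ⁻¹' {x | DecodingFails 𝒦 B x}) :=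
    hmeas (measurableSet_decodingFails 𝒦 B)
  have herr : Measurable fun ω =>
      ENNReal.ofReal (sqErr (block X L ω) fun _ => ∫ ω, X 0 ω ∂P) := by
    unfold sqErr block
    have := hX.measurable
    fun_prop
  refine le_trans ?_ (add_le_add (hD J hJ) hB)
  unfold meanDistortion
  rw [← lintegral_indicator hA, ← lintegral_add_right _ (herr.indicator hA)]
  -- Pointwise, the error is that of the quantizer if the decoder of `J` succeeds, and that of the
  -- constant mean on the common failure event otherwise.
  refine lintegral_mono fun ω => ?_
  by_cases h : ∃! u, IsCandidate B J (fun j => encode B j (block X L ω)) u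
  · simp only [decode_encode B J (g J) _ _ h]
    exact le_self_add
  · have hω : ω ∈ block X L ⁻¹' {x | DecodingFails 𝒦 B x} := ⟨J, hJ, h⟩
    simp only [decode, dif_neg h, Set.indicator_of_mem hω]
    exact le_add_self

/-- The source words with a codeword outside of its side codebook. -/
def uncovered (s : System K L) : Set (Vec L) := {x | ∃ i, s.codeword i x ∉ s.sideCode i}

lemma measurableSet_uncovered (s : System K L) : MeasurableSet s.uncovered :=
  s.measurableSet_quant fun c => ∃ i, s.label c i ∉ s.sideCode i

lemma tendsto_measureReal_uncovered [IsProbabilityMeasure P] (hX : IsIIDSource P X)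
    (hent : HasFiniteDiffEntropy P X) (s : ∀ L, System K L) {ε : ℝ} (hε : 0 < ε)
    (hcode : ∀ i, Tendsto (fun L => P {ω | block X L ω ∈ typicalSet P X L ε ∧
      (s L).codeword i (block X L ω) ∉ (s L).sideCode i}) atTop (𝓝 0)) :
    Tendsto (fun L => P.real (block X L ⁻¹' (s L).uncovered)) atTop (𝓝 0) := by
  have hlim := (tendsto_measure_notMem_typicalSet hX hent hε).add
    (tendsto_finsetSum Finset.univ fun i _ => hcode i)
  rw [Finset.sum_const_zero, add_zero] at hlim
  rw [← ENNReal.toReal_zero]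
  refine (ENNReal.tendsto_toReal ENNReal.zero_ne_top).comp
    (tendsto_of_tendsto_of_tendsto_of_le_of_le tendsto_const_nhds hlim
      (fun _ => zero_le) fun L => ?_)
  refine le_trans (measure_mono ?_) ((measure_union_le _ _).trans
    (add_le_add_right (measure_biUnion_finset_le Finset.univ _) _))
  rintro ω ⟨i, hi⟩
  by_cases h : block X L ω ∈ typicalSet P X L ε
  · exact Or.inr (Set.mem_biUnion (Finset.mem_univ i) ⟨h, hi⟩)
  · exact Or.inl h

/-- Random binning achieves the distortions of the quantizer with high probability. -/
lemma eventually_one_sub_le_probGood [IsProbabilityMeasure P] (hX : IsIIDSource P X)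
    (hent : HasFiniteDiffEntropy P X) (hX2 : MemLp (X 0) 2 P) (𝒦 : Finset (Finset (Fin K)))
    (s : ∀ L, System K L)
    (g : ∀ (L : ℕ) (J : Finset (Fin K)), (∀ j : J, (s L).side j) → Vec L)
    {ε : ℝ} (hε : 0 < ε)
    (hcode : ∀ i, Tendsto (fun L => P {ω | block X L ω ∈ typicalSet P X L ε ∧
      (s L).codeword i (block X L ω) ∉ (s L).sideCode i}) atTop (𝓝 0))
    {Rb γ : Fin K → ℝ} (hRb : ∀ i, 0 ≤ Rb i) (hγ : ∀ i, 0 < γ i)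
    {D : Finset (Fin K) → ℝ≥0}
    (hD : ∀ᶠ L in atTop, ∀ J ∈ 𝒦,
      meanDistortion P X L (fun x => g L J fun j => (s L).codeword j x) ≤ D J)
    (hrate : ∀ᶠ L in atTop, ∀ J ∈ 𝒦, ∀ S ⊆ J, S.Nonempty →
      ∀ v : ∀ j : ↥(J \ S), (s L).side j, (∀ j : ↥(J \ S), v j ∈ (s L).sideCode j) →
        ((s L).condTuples S (J \ S) v).Nonempty →
        ∑ i ∈ S, γ i + (1 / (L : ℝ)) * Real.logb 2 ((s L).condTuples S (J \ S) v).ncard <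
          ∑ i ∈ S, Rb i) {δ : ℝ} (hδ : 0 < δ) :
    ∀ᶠ L in atTop, 1 - δ ≤ probGood P X 𝒦 (s L) (g L) D (fun i => Rb i + δ) γ δ := by
  obtain ⟨η, hη, hUI⟩ := exists_setLIntegral_sqErr_const_le hX hX2 (∫ ω, X 0 ω ∂P) hδ
  have hN := tendsto_measureReal_uncovered hX hent s hε hcode
  have hlim := (hN.add (tendsto_failureBound hγ hδ)).div_const η
  rw [add_zero, zero_div] at hlim
  filter_upwards [hlim.eventually_le_const hδ, hN.eventually_lt_const one_pos, hD, hrate,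
    eventually_ne_atTop 0] with L hsmall hNL hDL hrateL hL
  have hNm : MeasurableSet (block X L ⁻¹' (s L).uncovered) :=
    measurable_block hX L (s L).measurableSet_uncovered
  have hcovered : ∀ ω, ω ∉ block X L ⁻¹' (s L).uncovered →
      ∀ i, (s L).codeword i (block X L ω) ∈ (s L).sideCode i := fun ω hω i => by
    by_contra hi
    exact hω ⟨i, hi⟩
  -- A covered source word shows that all side codebooks are nonempty. Hence `Binning` is nonempty
  -- and `probGood` is a genuine probability.
  obtain ⟨ω₀, hω₀⟩ : ∃ ω, ω ∉ block X L ⁻¹' (s L).uncovered := by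
    by_contra! hall
    rw [Set.eq_univ_of_forall hall, probReal_univ] at hNL
    exact lt_irrefl _ hNL
  have hne : Nonempty ((s L).Binning (fun i => Rb i + δ) γ) :=
    ⟨fun i _ _ => ⟨_, hcovered ω₀ hω₀ i⟩⟩
  have hβ : 0 ≤ failureBound γ δ L := by unfold failureBound; positivity
  have hfrac := frac_lt_measureReal_le P
    (E := fun B : (s L).Binning (fun i => Rb i + δ) γ =>
      block X L ⁻¹' {x | DecodingFails 𝒦 B x})
    (fun B => measurable_block hX L (measurableSet_decodingFails 𝒦 B)) hNm hβ hη
    fun ω hω => frac_decodingFails_le_failureBound hδ hL hRb hrateL _ (hcovered ω hω)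
  refine le_trans ?_ ((one_sub_frac_le _).trans
    (frac_mono (p := fun B : (s L).Binning (fun i => Rb i + δ) γ =>
      ¬ η < P.real (block X L ⁻¹' {x | DecodingFails 𝒦 B x})) fun B hB => ?_))
  · linarith
  · refine isGood_of_setLIntegral_le hX hDL B (hUI L _
      (measurable_block hX L (measurableSet_decodingFails 𝒦 B)) ?_)
    rw [← ENNReal.ofReal_toReal (measure_ne_top P _)]
    exact ENNReal.ofReal_le_ofReal (not_lt.1 hB)

/-! ### From random binnings to codes -/

/-- A binning as a multiple-description code. -/
noncomputable def toCode {s : System K L} (B : s.Binning R γ)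
    (g : ∀ J : Finset (Fin K), (∀ j : J, s.side j) → Vec L) (m : ℝ) :
    Code K L fun i => numBins L (R i) + 1 where
  enc i x := (finSuccEquivLast (n := numBins L (R i))).symm (encode B i x)
  enc_measurable i t _ := s.measurableSet_quant fun c =>
    (finSuccEquivLast (n := numBins L (R i))).symm (binIndex B i (s.label c i)) ∈ t
  dec J y := decode B J (g J) m fun j => finSuccEquivLast (y j)

lemma toCode_dec_enc (B : s.Binning R γ) (g : ∀ J : Finset (Fin K), (∀ j : J, s.side j) → Vec L)
    (m : ℝ) (J : Finset (Fin K)) (x : Vec L) :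
    ((toCode B g m).dec J fun j => (toCode B g m).enc j x) =
      decode B J (g J) m fun j => encode B j x :=
  congrArg (decode B J (g J) m) (funext fun _ => Equiv.apply_symm_apply _ _)

/-- The additional symbol `⊤` at most doubles $2^{L(r+\delta')}\ge1$, and the rate slack
$\delta-\delta'$ absorbs this factor once $L(\delta-\delta')\ge1$. -/
lemma numBins_add_one_le {r δ δ' : ℝ} (hr : 0 ≤ r + δ') (hL : 1 ≤ (L : ℝ) * (δ - δ')) :
    ((numBins L (r + δ') + 1 : ℕ) : ℝ) ≤ (2 : ℝ) ^ ((L : ℝ) * (r + δ)) := by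
  have h1 : (1 : ℝ) ≤ (2 : ℝ) ^ ((L : ℝ) * (r + δ')) :=
    Real.one_le_rpow (by norm_num) (by positivity)
  have h2 : (2 : ℝ) ≤ (2 : ℝ) ^ ((L : ℝ) * (δ - δ')) := by
    simpa using Real.rpow_le_rpow_of_exponent_le (by norm_num : (1 : ℝ) ≤ 2) hL
  have h3 : (numBins L (r + δ') : ℝ) ≤ (2 : ℝ) ^ ((L : ℝ) * (r + δ')) :=
    Nat.floor_le (by positivity)
  have h4 : (L : ℝ) * (r + δ) = (L : ℝ) * (r + δ') + (L : ℝ) * (δ - δ') := by ring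
  rw [h4, Real.rpow_add two_pos]
  push_cast
  nlinarith

lemma achievable_of_eventually_probGood {𝒦 : Finset (Finset (Fin K))} {s : ∀ L, System K L}
    {g : ∀ (L : ℕ) (J : Finset (Fin K)), (∀ j : J, (s L).side j) → Vec L}
    {Rb γ : Fin K → ℝ} (hRb : ∀ i, 0 ≤ Rb i) {D : Finset (Fin K) → ℝ≥0}
    (h : ∀ δ : ℝ, 0 < δ → ∀ᶠ L in atTop,
      1 - δ ≤ probGood P X 𝒦 (s L) (g L) D (fun i => Rb i + δ) γ δ) :
    Achievable P X 𝒦 Rb D := by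
  intro δ hδ
  -- The bound `δ / 2` leaves slack in the rate for the special symbol; the bound `1 / 2` keeps the
  -- success probability positive, so that a good binning exists.
  have hδ' : 0 < min (δ / 2) (1 / 2) := by positivity
  have hle : min (δ / 2) (1 / 2) ≤ δ / 2 := min_le_left _ _
  have hle' : min (δ / 2) (1 / 2) ≤ 1 / 2 := min_le_right _ _
  have hlarge : ∀ᶠ L : ℕ in atTop, 1 ≤ (L : ℝ) * (δ - min (δ / 2) (1 / 2)) :=
    (tendsto_natCast_atTop_atTop.atTop_mul_const
      (show 0 < δ - min (δ / 2) (1 / 2) by linarith)).eventually_ge_atTop 1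
  generalize min (δ / 2) (1 / 2) = δ' at *
  filter_upwards [h δ' hδ', hlarge] with L hprob hL
  obtain ⟨B, hB⟩ : ∃ B : (s L).Binning (fun i => Rb i + δ') γ,
      IsGood P X 𝒦 (g L) D δ' B := by
    by_contra! hno
    have : IsEmpty {B : (s L).Binning (fun i => Rb i + δ') γ // IsGood P X 𝒦 (g L) D δ' B} :=
      ⟨fun B => hno B.1 B.2⟩
    rw [probGood, Nat.card_of_isEmpty, Nat.cast_zero, zero_div] at hprob
    linarith
  refine ⟨_, toCode B (g L) (∫ ω, X 0 ω ∂P), fun i => ?_, fun J hJ => ?_⟩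
  · exact numBins_add_one_le (by linarith [hRb i]) hL
  · simp only [toCode_dec_enc]
    exact (hB J hJ).trans (add_le_add_right (ENNReal.ofReal_le_ofReal (hle.trans (by linarith))) _)

end Source

end System

end MDLVQ

theorem theorem7p1 {Ω : Type*} [MeasurableSpace Ω] (P : Measure Ω) [IsProbabilityMeasure P]
    (X : ℕ → Ω → ℝ) (hX : MDLVQ.IsIIDSource P X) (hent : MDLVQ.HasFiniteDiffEntropy P X)
    (hX2 : MemLp (X 0) 2 P)
    {K : ℕ} (𝒦 : Finset (Finset (Fin K)))
    (s : ∀ L, MDLVQ.System K L)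
    (g : ∀ (L : ℕ) (J : Finset (Fin K)), (∀ j : J, (s L).side j) → MDLVQ.Vec L)
    (ε : ℝ) (hε : 0 < ε)
    (hcode : ∀ i, Tendsto (fun L => P {ω | MDLVQ.block X L ω ∈ MDLVQ.typicalSet P X L ε ∧
      (s L).codeword i (MDLVQ.block X L ω) ∉ (s L).sideCode i}) atTop (𝓝 0))
    (Rb γ : Fin K → ℝ) (hRb : ∀ i, 0 ≤ Rb i) (hγ : ∀ i, 0 < γ i)
    (D : Finset (Fin K) → ℝ≥0)
    (hD : ∀ᶠ L in atTop, ∀ J ∈ 𝒦,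
      MDLVQ.meanDistortion P X L (fun x => g L J fun j => (s L).codeword j x) ≤ D J)
    (hrate : ∀ᶠ L in atTop, ∀ J ∈ 𝒦, ∀ S ⊆ J, S.Nonempty →
      ∀ v : ∀ j : ↥(J \ S), (s L).side j, (∀ j : ↥(J \ S), v j ∈ (s L).sideCode j) →
        ((s L).condTuples S (J \ S) v).Nonempty →
        ∑ i ∈ S, γ i + (1 / (L : ℝ)) * Real.logb 2 ((s L).condTuples S (J \ S) v).ncard <
          ∑ i ∈ S, Rb i) :
    MDLVQ.Achievable P X 𝒦 Rb D ∧
      ∀ δ : ℝ, 0 < δ → ∀ᶠ L in atTop,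
        1 - δ ≤ MDLVQ.System.probGood P X 𝒦 (s L) (g L) D (fun i => Rb i + δ) γ δ := by
  have hprob := fun δ (hδ : 0 < δ) => MDLVQ.System.eventually_one_sub_le_probGood hX hent hX2 𝒦 s g
    hε hcode hRb hγ hD hrate hδ
  exact ⟨MDLVQ.System.achievable_of_eventually_probGood hRb hprob, hprob⟩
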